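/- Let $k\ge 0$ be an integer. A $k$-uniform hypergraph consists of a finite vertex set and a set of $k$-element subsets of it, called edges. For a $k$-uniform hypergraph $F$, let $\mathrm{ex}^{(k)}(n,F)$ denote the maximum number of edges of a $k$-uniform hypergraph on exactly $n$ vertices that contains no copy of $F$ as a (not necessarily induced) subgraph; that is, there is no injective map of $V(F)$ into its vertex set sending every edge of $F$ to an edge. (If no such hypergraph on $n$ vertices exists, put $\mathrm{ex}^{(k)}(n,F)=0$.) **Proposition (a hypergraph version of the Erdős–Stone theorem).** Let $F$ and $F_0$ be $k$-uniform hypergraphs such that $F$ is a "blow-up" of $F_0$, i.e. there is a map $V(F)\to V(F_0)$ under which the image of each edge of $F$ is an edge of $F_0$. Then $$\mathrm{ex}^{(k)}(n,F)\le \mathrm{ex}^{(k)}(n,F_0)+o(n^k)\qquad (n\to\infty),$$ where $k$, $F$ and $F_0$ are fixed. -/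

import Mathlib

namespace Hypergraph

/-- Every edge has exactly `k` vertices. -/
def IsUniform {α : Type*} (H : Hypergraph α) (k : ℕ) : Prop :=
  ∀ e ∈ H.edgeSet, e.encard = k

/-- The vertex map `f : V(H) → V(K)` sends each edge of `H` onto an edge of `K`. -/
def MapsEdges {α β : Type*} (H : Hypergraph α) (K : Hypergraph β)
    (f : H.vertexSet → K.vertexSet) : Prop :=
  ∀ e ∈ H.edgeSet, (fun x : H.vertexSet => (f x : β)) '' {x | (x : α) ∈ e} ∈ K.edgeSet

/-- `F` is a blow-up of `F₀`: some vertex map sends each edge of `F` to an edge of `F₀`. -/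
def IsBlowUp {α β : Type*} (F : Hypergraph α) (F₀ : Hypergraph β) : Prop :=
  ∃ f : F.vertexSet → F₀.vertexSet, F.MapsEdges F₀ f

/-- `G` contains a copy of `F` as a (not necessarily induced) subgraph. -/
def ContainsCopy {α β : Type*} (G : Hypergraph β) (F : Hypergraph α) : Prop :=
  ∃ f : F.vertexSet → G.vertexSet, Function.Injective f ∧ F.MapsEdges G f

/-- The set of edge numbers of the `k`-uniform hypergraphs on exactly `n` vertices that contain
no copy of `F`. -/
def freeEdgeCounts {α : Type*} (k n : ℕ) (F : Hypergraph α) : Set ℕ :=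
  {m | ∃ G : Hypergraph (Fin n), G.vertexSet = Set.univ ∧ G.IsUniform k ∧
    ¬ G.ContainsCopy F ∧ G.edgeSet.ncard = m}

theorem bddAbove_freeEdgeCounts {α : Type*} (k n : ℕ) (F : Hypergraph α) :
    BddAbove (freeEdgeCounts k n F) := by
  refine ⟨(Set.univ : Set (Set (Fin n))).ncard, ?_⟩
  rintro m ⟨G, -, -, -, rfl⟩
  exact Set.ncard_le_ncard (Set.subset_univ _) (Set.toFinite _)

/-- The Turán number `ex^(k)(n, F)`: the maximum number of edges of a `k`-uniform hypergraph on
exactly `n` vertices with no copy of `F` (it is `0` if there is no such hypergraph). -/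
noncomputable def turanNumber {α : Type*} (k n : ℕ) (F : Hypergraph α) : ℕ :=
  sSup (freeEdgeCounts k n F)

end Hypergraph

section

open Finset

/-! The proof combines supersaturation with Erdős's theorem on complete multipartite hypergraphs.
Write v for the number of vertices of F₀. Averaging over M-subsets shows that ex(n, F₀) / C(n, k) is
nonincreasing for large n, hence convergent. With M fixed so that this density is near its limit,
`card_div_choose_le` shows that a family with εn^k edges more than ex(n, F₀) has at least δn^v
copies of F₀. These copies form a dense v-ary relation, so `exists_forall_piFinset_subset` (iterated
Kővári–Sós–Turán) yields large sets A i, one for each vertex i of F₀, all of whose transversals are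
copies. Sending each vertex x of F injectively into A (f x), where f is the blow-up map, embeds F
(`exists_card_isCopy_le`). Hence an F-free family has few copies of F₀, and so few edges beyond
ex(n, F₀). -/

/-! ### Complete multipartite patterns in dense relations -/

theorem Nat.pow_mul_choose_le_choose {δ : ℝ} (hδ : 0 ≤ δ) {n m t : ℕ}
    (h : δ * n ≤ ((m + 1 - t : ℕ) : ℝ)) : δ ^ t * (n.choose t : ℝ) ≤ m.choose t := by
  have h1 := Nat.choose_le_pow_div (α := ℝ) t n
  have h2 := Nat.pow_le_choose (α := ℝ) t m
  calc δ ^ t * (n.choose t : ℝ) ≤ δ ^ t * ((n : ℝ) ^ t / t.factorial) := by gcongr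
    _ = (δ * n) ^ t / t.factorial := by rw [mul_pow]; ring
    _ ≤ ((m + 1 - t : ℕ) : ℝ) ^ t / t.factorial := by gcongr
    _ ≤ _ := h2

/-- One step of the Kővári–Sós–Turán argument: a dense relation between `X` and `Y` contains all
pairs `T × Y'` for some `t`-element set `T` and some set `Y'` of positive density. -/
theorem exists_card_eq_and_dense_common_neighbors {δ : ℝ} (hδ : 0 < δ) (hδ₁ : δ ≤ 1) {t : ℕ}
    {X Y : Type*} [Fintype X] [Fintype Y] [DecidableEq X] [DecidableEq Y] (R : X → Y → Prop)
    [∀ x y, Decidable (R x y)] (ht : (t : ℝ) ≤ δ / 4 * Fintype.card X)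
    (hX : 0 < Fintype.card X)
    (hR : δ * (Fintype.card X * Fintype.card Y) ≤ (#{p : X × Y | R p.1 p.2} : ℝ)) :
    ∃ T : Finset X, #T = t ∧
      (δ / 2) * (δ / 4) ^ t * Fintype.card Y ≤ (#{y : Y | ∀ x ∈ T, R x y} : ℝ) := by
  set n := Fintype.card X with hn
  set N := Fintype.card Y with hN
  let d : Y → ℕ := fun y => #{x : X | R x y}
  have hd : ∀ y, d y ≤ n := fun y => card_le_univ _
  have hsum : ∑ y, (d y : ℝ) = #{p : X × Y | R p.1 p.2} := by
    rw [← Nat.cast_sum]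
    congr 1
    rw [card_filter, Fintype.sum_prod_type_right]
    simp only [d, card_filter]
  let B : Finset Y := {y | δ / 2 * n ≤ d y}
  have hn0 : (0 : ℝ) < n := by exact_mod_cast hX
  -- Points outside `B` account for at most half of the δnN related pairs, and each point of `B` for
  -- at most n.
  have hB : δ / 2 * N ≤ #B := by
    have h1 : ∀ y, (d y : ℝ) ≤ δ / 2 * n + if y ∈ B then (n : ℝ) else 0 := by
      intro y
      have h2 : (d y : ℝ) ≤ n := by exact_mod_cast hd y
      split_ifs with hy
      · have : 0 ≤ δ / 2 * n := by positivity
        linarith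
      · simp only [B, mem_filter, mem_univ, true_and, not_le] at hy
        linarith
    have h2 := Finset.sum_le_sum fun y (_ : y ∈ (univ : Finset Y)) => h1 y
    rw [hsum, sum_add_distrib, sum_const, ← sum_filter, sum_const, card_univ, ← hN] at h2
    simp only [nsmul_eq_mul, filter_mem_eq_inter, univ_inter] at h2
    have h3 : n * (δ / 2 * N) ≤ n * (#B : ℝ) := by nlinarith
    exact le_of_mul_le_mul_left h3 hn0
  have hcount : ∑ T ∈ (univ : Finset X).powersetCard t, #{y : Y | ∀ x ∈ T, R x y}
      = ∑ y, (d y).choose t := by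
    have := sum_card_bipartiteAbove_eq_sum_card_bipartiteBelow
      (s := (univ : Finset X).powersetCard t) (t := (univ : Finset Y))
      (fun T y => ∀ x ∈ T, R x y)
    refine this.trans (sum_congr rfl fun y _ => ?_)
    rw [← card_powersetCard]
    congr 1
    ext T
    simp [bipartiteBelow, mem_powersetCard, subset_iff, and_comm]
  have hlow : (δ / 2) * (δ / 4) ^ t * N * n.choose t ≤ ∑ y, ((d y).choose t : ℝ) := by
    calc (δ / 2) * (δ / 4) ^ t * N * n.choose t
        = (δ / 2 * N) * ((δ / 4) ^ t * n.choose t) := by ring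
      _ ≤ #B * ((δ / 4) ^ t * n.choose t) := by gcongr
      _ = ∑ y ∈ B, ((δ / 4) ^ t * n.choose t) := by rw [sum_const, nsmul_eq_mul]
      _ ≤ ∑ y ∈ B, ((d y).choose t : ℝ) := by
        refine sum_le_sum fun y hy => Nat.pow_mul_choose_le_choose (by positivity) ?_
        simp only [B, mem_filter, mem_univ, true_and] at hy
        -- Keeps the natural subtraction `d y + 1 - t` from truncating; it is then at least δn/2 -
        -- δn/4.
        have : t ≤ d y + 1 := by
          have : (t : ℝ) ≤ (d y + 1 : ℝ) := by nlinarith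
          exact_mod_cast this
        push_cast [Nat.cast_sub this]
        linarith
      _ ≤ ∑ y, ((d y).choose t : ℝ) :=
        sum_le_sum_of_subset_of_nonneg (subset_univ _) fun _ _ _ => by positivity
  -- Otherwise every t-set T has too few common neighbours, and summing over T contradicts the lower
  -- bound on pairs (T, y).
  by_contra! hcon
  have hpc : ((univ : Finset X).powersetCard t).Nonempty := by
    rw [powersetCard_nonempty, card_univ]
    have : (t : ℝ) ≤ n := by nlinarith
    exact_mod_cast this
  have hlt := sum_lt_sum_of_nonempty hpc
    (fun T hT => hcon T (mem_powersetCard.1 hT).2)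
  rw [sum_const, card_powersetCard, card_univ, nsmul_eq_mul, ← Nat.cast_sum, hcount] at hlt
  push_cast at hlt
  rw [← hn] at hlt
  linarith

/-- Erdős's theorem on complete multipartite uniform hypergraphs, for relations: a dense `v`-ary
relation on a large finite set contains a product of `v` sets with `t` elements each. -/
theorem exists_forall_piFinset_subset (t v : ℕ) {δ : ℝ} (hδ : 0 < δ) (hδ₁ : δ ≤ 1) :
    ∃ N : ℕ, ∀ n ≥ N, ∀ R : Finset (Fin v → Fin n), δ * (n : ℝ) ^ v ≤ #R →
      ∃ A : Fin v → Finset (Fin n), (∀ i, #(A i) = t) ∧ ∀ φ, (∀ i, φ i ∈ A i) → φ ∈ R := by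
  induction v generalizing δ with
  | zero =>
    refine ⟨0, fun n _ R hR => ⟨fun _ => ∅, fun i => i.elim0, fun φ _ => ?_⟩⟩
    have hne : R.Nonempty := by
      rw [nonempty_iff_ne_empty]
      rintro rfl
      simp at hR
      linarith
    obtain ⟨ψ, hψ⟩ := hne
    rwa [Subsingleton.elim φ ψ]
  | succ v ih =>
    have hδ' : δ / 2 * (δ / 4) ^ t ≤ 1 := by
      have : (δ / 4) ^ t ≤ 1 := pow_le_one₀ (by positivity) (by linarith)
      have h0 : 0 ≤ (δ / 4) ^ t := by positivity
      nlinarith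
    obtain ⟨N, hN⟩ := ih (δ := δ / 2 * (δ / 4) ^ t) (by positivity) hδ'
    refine ⟨max N (⌈t / (δ / 4)⌉₊ + 1), fun n hn R hR => ?_⟩
    have hn1 : ⌈t / (δ / 4)⌉₊ + 1 ≤ n := (le_max_right _ _).trans hn
    have ht : (t : ℝ) ≤ δ / 4 * n := by
      have h1 := Nat.le_ceil (t / (δ / 4))
      have h2 : ((⌈t / (δ / 4)⌉₊ : ℕ) : ℝ) ≤ n := by exact_mod_cast (by lia)
      have := (div_le_iff₀ (by positivity)).1 (h1.trans h2)
      linarith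
    have hcard : #{p : Fin n × (Fin v → Fin n) | (Fin.cons p.1 p.2 : Fin (v + 1) → Fin n) ∈ R}
        = #R := by
      refine card_bij' (fun p _ => Fin.cons p.1 p.2) (fun φ _ => (φ 0, Fin.tail φ)) ?_ ?_ ?_ ?_
      · simp
      · simp
      · simp
      · simp
    obtain ⟨T, hT, hT'⟩ := exists_card_eq_and_dense_common_neighbors (t := t) hδ hδ₁
      (fun (x : Fin n) (y : Fin v → Fin n) => (Fin.cons x y : Fin (v + 1) → Fin n) ∈ R)
      (by simpa using ht) (by simp; lia) (by
        rw [hcard]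
        simpa [pow_succ'] using hR)
    obtain ⟨A, hA, hAR⟩ := hN n ((le_max_left _ _).trans hn) _ (by simpa using hT')
    refine ⟨Fin.cons T A, fun i => ?_, fun φ hφ => ?_⟩
    · refine Fin.cases ?_ (fun j => ?_) i
      · simpa using hT
      · simpa using hA j
    · have h1 := hAR (Fin.tail φ) fun i => by simpa [Fin.tail] using hφ i.succ
      simp only [mem_filter, mem_univ, true_and] at h1
      have h2 := h1 (φ 0) (by simpa using hφ 0)
      rwa [Fin.cons_self_tail] at h2

theorem exists_forall_piFinset_subset_of_fintype (ι : Type*) [Fintype ι] [DecidableEq ι] (t : ℕ)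
    {δ : ℝ} (hδ : 0 < δ) :
    ∃ N : ℕ, ∀ n ≥ N, ∀ R : Finset (ι → Fin n), δ * (n : ℝ) ^ Fintype.card ι ≤ #R →
      ∃ A : ι → Finset (Fin n), (∀ i, #(A i) = t) ∧ ∀ φ, (∀ i, φ i ∈ A i) → φ ∈ R := by
  obtain ⟨N, hN⟩ := exists_forall_piFinset_subset t (Fintype.card ι) (δ := min δ 1)
    (by positivity) (min_le_right _ _)
  refine ⟨N, fun n hn R hR => ?_⟩
  let e := Fintype.equivFin ι
  obtain ⟨A, hA, hAR⟩ := hN n hn (R.map (e.arrowCongr (Equiv.refl (Fin n))).toEmbedding) (by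
    rw [card_map]
    exact le_trans (by gcongr; exact min_le_left _ _) hR)
  refine ⟨fun i => A (e i), fun i => hA _, fun φ hφ => ?_⟩
  have := hAR (φ ∘ e.symm) fun i => by simpa using hφ (e.symm i)
  rw [mem_map_equiv] at this
  convert this using 1
  ext i
  simp

/-! ### Supersaturation and Turán densities -/

theorem card_filter_superset_powersetCard {X : Type*} [Fintype X] [DecidableEq X] (M : ℕ)
    (s : Finset X) (hs : #s ≤ M) :
    #{S ∈ (univ : Finset X).powersetCard M | s ⊆ S}
      = (Fintype.card X - #s).choose (M - #s) := by
  rw [← card_compl, ← card_powersetCard]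
  refine card_bij' (fun S _ => S \ s) (fun U _ => U ∪ s) ?_ ?_ ?_ ?_
  · intro S hS
    simp only [mem_filter, mem_powersetCard, subset_univ, true_and] at hS ⊢
    exact ⟨fun x hx => by simp at hx ⊢; exact hx.2, by rw [card_sdiff_of_subset hS.2, hS.1]⟩
  · intro U hU
    simp only [mem_filter, mem_powersetCard, subset_univ, true_and] at hU ⊢
    have hd : Disjoint U s := by
      rw [disjoint_left]
      intro x hx
      simpa using hU.1 hx
    exact ⟨by rw [card_union_of_disjoint hd, hU.2]; lia, subset_union_right⟩
  · intro S hS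
    simp only [mem_filter] at hS
    exact sdiff_union_of_subset hS.2
  · intro U hU
    simp only [mem_powersetCard] at hU
    have hd : Disjoint U s := by
      rw [disjoint_left]
      intro x hx
      simpa using hU.1 hx
    exact union_sdiff_cancel_right hd

namespace Hypergraph

/-- The map `φ` is an embedding of `F` into the family `E`, viewed as the edge set of a hypergraph
with vertex set `X`. -/
def IsCopy {α X : Type*} (F : Hypergraph α) (E : Finset (Finset X)) (φ : F.vertexSet → X) : Prop :=
  Function.Injective φ ∧ ∀ e ∈ F.edgeSet, ∃ e' ∈ E, (e' : Set X) = φ '' {x | (x : α) ∈ e}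

/-- Replaces hypergraphs by finite families of finsets. The case of no admissible hypergraph causes
no trouble, since the supremum of the empty set in ℕ is 0. -/
theorem turanNumber_le_iff {α : Type*} {k n m : ℕ} {F : Hypergraph α} :
    turanNumber k n F ≤ m ↔ ∀ E : Finset (Finset (Fin n)), (∀ e ∈ E, #e = k) →
      (∀ φ, ¬ F.IsCopy E φ) → #E ≤ m := by
  classical
  constructor
  · intro h E hE hF
    refine le_trans (le_csSup (bddAbove_freeEdgeCounts k n F) ?_) h
    refine ⟨⟨Set.univ, (fun e : Finset (Fin n) => (e : Set (Fin n))) '' E,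
      fun _ _ => Set.subset_univ _⟩, rfl, ?_, ?_, ?_⟩
    · rintro _ ⟨e, he, rfl⟩
      simp [hE e he]
    · rintro ⟨f, hf, hfe⟩
      refine hF (fun x => (f x : Fin n)) ⟨fun x y hxy => hf (Subtype.ext hxy), fun e he => ?_⟩
      obtain ⟨e', he', h'⟩ := hfe e he
      exact ⟨e', he', h'⟩
    · change ((fun e : Finset (Fin n) => (e : Set (Fin n))) '' E).ncard = #E
      rw [Set.ncard_image_of_injective _ coe_injective, Set.ncard_coe_finset]
  · intro h
    refine csSup_le' ?_
    rintro _ ⟨G, hV, hG, hF, rfl⟩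
    let E : Finset (Finset (Fin n)) := {e | (e : Set (Fin n)) ∈ G.edgeSet}
    have hE : G.edgeSet = (fun e : Finset (Fin n) => (e : Set (Fin n))) '' E := by
      ext e
      constructor
      · intro he
        exact ⟨e.toFinite.toFinset, by simpa [E] using he, by simp⟩
      · rintro ⟨e, he, rfl⟩
        simpa [E] using he
    rw [hE, Set.ncard_image_of_injective _ coe_injective, Set.ncard_coe_finset]
    refine h E (fun e he => ?_) fun φ hφ => hF ?_
    · have := hG e (by simpa [E] using he)
      simpa using this
    · refine ⟨fun x => ⟨φ x, by simp [hV]⟩, fun x y hxy => hφ.1 (congrArg Subtype.val hxy),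
        fun e he => ?_⟩
      obtain ⟨e', he', h'⟩ := hφ.2 e he
      rw [← h']
      simpa [E] using he'

/-- An induced subfamily on `M` vertices without a copy of `F` has at most `turanNumber k M F`
edges. -/
theorem card_filter_subset_le_turanNumber {α : Type*} {k n : ℕ} {F : Hypergraph α}
    {E : Finset (Finset (Fin n))} (hE : ∀ e ∈ E, #e = k) (S : Finset (Fin n))
    (hS : ∀ φ, F.IsCopy E φ → ¬ ∀ x, φ x ∈ S) :
    #{e ∈ E | e ⊆ S} ≤ turanNumber k (#S) F := by
  classical
  let σ : Fin (#S) ↪ Fin n := (S.orderEmbOfFin rfl).toEmbedding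
  have hσ : ∀ x, σ x ∈ S := fun x => S.orderEmbOfFin_mem rfl x
  have hσS : univ.map σ = S := by
    refine eq_of_subset_of_card_le (fun y hy => ?_) (by simp)
    obtain ⟨x, -, rfl⟩ := mem_map.1 hy
    exact hσ x
  let E' : Finset (Finset (Fin (#S))) := {e | e.map σ ∈ E}
  have hcard : #{e ∈ E | e ⊆ S} ≤ #E' := by
    rw [← card_map (mapEmbedding σ).toEmbedding (s := E')]
    refine card_le_card fun e he => ?_
    obtain ⟨he, heS⟩ := mem_filter.1 he
    rw [← hσS, subset_map_iff] at heS
    obtain ⟨u, -, rfl⟩ := heS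
    exact mem_map.2 ⟨u, by simpa [E'] using he, rfl⟩
  refine hcard.trans (turanNumber_le_iff.1 le_rfl E' (fun e he => ?_) fun φ hφ => ?_)
  · simpa using hE _ (mem_filter.1 he).2
  · refine hS (fun x => σ (φ x)) ⟨σ.injective.comp hφ.1, fun e he => ?_⟩ fun x => hσ _
    obtain ⟨e', he', h'⟩ := hφ.2 e he
    refine ⟨e'.map σ, (mem_filter.1 he').2, ?_⟩
    rw [coe_map, h', Set.image_image]

-- Double counting of pairs e ⊆ S with #S = M. A set S free of copies spans at most ex(M, F) edges;
-- any other spans at most C(M, k), charged to a copy inside it.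
open Classical in
theorem card_mul_choose_le {α : Type*} {k n M : ℕ} {F : Hypergraph α} [Fintype F.vertexSet]
    {E : Finset (Finset (Fin n))} (hE : ∀ e ∈ E, #e = k) (hk : k ≤ M)
    (hv : Fintype.card F.vertexSet ≤ M) :
    #E * (n - k).choose (M - k) ≤ n.choose M * turanNumber k M F +
      #{φ | F.IsCopy E φ} * (n - Fintype.card F.vertexSet).choose (M - Fintype.card F.vertexSet)
        * M.choose k := by
  set v := Fintype.card F.vertexSet
  set C : Finset (F.vertexSet → Fin n) := {φ | F.IsCopy E φ} with hC
  set P := (univ : Finset (Fin n)).powersetCard M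
  have h1 : ∑ S ∈ P, #{e ∈ E | e ⊆ S} = #E * (n - k).choose (M - k) := by
    have := sum_card_bipartiteAbove_eq_sum_card_bipartiteBelow (s := P) (t := E)
      (fun S e => e ⊆ S)
    refine this.trans ?_
    rw [← smul_eq_mul, ← sum_const]
    refine sum_congr rfl fun e he => ?_
    have := card_filter_superset_powersetCard M e ((hE e he).trans_le hk)
    rwa [hE e he, Fintype.card_fin] at this
  have h2 : ∑ S ∈ P, #{φ ∈ C | ∀ x, φ x ∈ S} = #C * (n - v).choose (M - v) := by
    have := sum_card_bipartiteAbove_eq_sum_card_bipartiteBelow (s := P) (t := C)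
      (fun S φ => ∀ x, φ x ∈ S)
    refine this.trans ?_
    rw [← smul_eq_mul, ← sum_const]
    refine sum_congr rfl fun φ hφ => ?_
    have hinj : Function.Injective φ := (mem_filter.1 hφ).2.1
    have hc : #(univ.image φ) = v := by
      rw [card_image_of_injective _ hinj, card_univ]
    have := card_filter_superset_powersetCard M (univ.image φ) (hc.trans_le hv)
    rw [hc, Fintype.card_fin] at this
    rw [← this]
    congr 1
    ext S
    simp [bipartiteBelow, P, image_subset_iff]
  have h3 : ∀ S ∈ P, #{e ∈ E | e ⊆ S} ≤
      turanNumber k M F + #{φ ∈ C | ∀ x, φ x ∈ S} * M.choose k := by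
    intro S hS
    have hSM : #S = M := (mem_powersetCard.1 hS).2
    by_cases h : ∃ φ ∈ C, ∀ x, φ x ∈ S
    · obtain ⟨φ, hφ, hφS⟩ := h
      have hpos : 0 < #{φ ∈ C | ∀ x, φ x ∈ S} := card_pos.2 ⟨φ, mem_filter.2 ⟨hφ, hφS⟩⟩
      have : #{e ∈ E | e ⊆ S} ≤ M.choose k := by
        rw [← hSM, ← card_powersetCard]
        refine card_le_card fun e he => ?_
        obtain ⟨he, heS⟩ := mem_filter.1 he
        exact mem_powersetCard.2 ⟨heS, hE e he⟩
      nlinarith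
    · push Not at h
      have := card_filter_subset_le_turanNumber (F := F) hE S fun φ hφ hφS => by
        obtain ⟨x, hx⟩ := h φ (by simpa [C] using hφ)
        exact hx (hφS x)
      rw [hSM] at this
      lia
  have := sum_le_sum h3
  rw [h1, sum_add_distrib, ← sum_mul, h2, sum_const, card_powersetCard, card_univ,
    Fintype.card_fin, smul_eq_mul] at this
  exact this

open Classical in
/-- Supersaturation by averaging over the `M`-element vertex subsets. -/
theorem card_div_choose_le {α : Type*} {k n M : ℕ} {F : Hypergraph α} [Fintype F.vertexSet]
    {E : Finset (Finset (Fin n))} (hE : ∀ e ∈ E, #e = k) (hk : k ≤ M)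
    (hv : Fintype.card F.vertexSet ≤ M) (hM : M ≤ n) :
    (#E : ℝ) / n.choose k ≤ turanNumber k M F / M.choose k +
      #{φ | F.IsCopy E φ} / n.choose (Fintype.card F.vertexSet)
        * M.choose (Fintype.card F.vertexSet) := by
  have h := card_mul_choose_le (F := F) hE hk hv
  set v := Fintype.card F.vertexSet
  have hk' : (n.choose M * M.choose k : ℝ) = n.choose k * (n - k).choose (M - k) := by
    exact_mod_cast Nat.choose_mul hk
  have hv' : (n.choose M * M.choose v : ℝ) = n.choose v * (n - v).choose (M - v) := by
    exact_mod_cast Nat.choose_mul hv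
  have p1 : (0 : ℝ) < n.choose M := by exact_mod_cast Nat.choose_pos hM
  have p2 : (0 : ℝ) < M.choose k := by exact_mod_cast Nat.choose_pos hk
  have p3 : (0 : ℝ) < n.choose k := by exact_mod_cast Nat.choose_pos (hk.trans hM)
  have p4 : (0 : ℝ) < n.choose v := by exact_mod_cast Nat.choose_pos (hv.trans hM)
  have h' : (#E : ℝ) * (n - k).choose (M - k) ≤ n.choose M * turanNumber k M F +
      #{φ | F.IsCopy E φ} * (n - v).choose (M - v) * M.choose k := by exact_mod_cast h
  have e1 : ((n - k).choose (M - k) : ℝ) = n.choose M * M.choose k / n.choose k := by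
    rw [hk']; field_simp
  have e2 : ((n - v).choose (M - v) : ℝ) = n.choose M * M.choose v / n.choose v := by
    rw [hv']; field_simp
  rw [e1, e2] at h'
  have p5 : (0 : ℝ) < n.choose M * M.choose k := by positivity
  refine le_of_mul_le_mul_left ?_ p5
  have l : (n.choose M * M.choose k : ℝ) * (#E / n.choose k)
      = #E * (n.choose M * M.choose k / n.choose k) := by ring
  rw [l]
  refine h'.trans (le_of_eq ?_)
  generalize (#{φ | F.IsCopy E φ} : ℝ) = c
  field_simp

theorem turanNumber_div_choose_le {α : Type*} {k n M : ℕ} {F : Hypergraph α}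
    [Fintype F.vertexSet] (hk : k ≤ M) (hv : Fintype.card F.vertexSet ≤ M) (hM : M ≤ n) :
    (turanNumber k n F : ℝ) / n.choose k ≤ turanNumber k M F / M.choose k := by
  classical
  have p : (0 : ℝ) < n.choose k := by exact_mod_cast Nat.choose_pos (hk.trans hM)
  rw [div_le_iff₀ p]
  -- The floor turns the real bound into a natural one, as `turanNumber_le_iff` requires.
  refine (Nat.le_floor_iff (by positivity)).1 (turanNumber_le_iff.2 fun E hE hF => ?_)
  rw [Nat.le_floor_iff (by positivity), ← div_le_iff₀ p]
  have := card_div_choose_le (F := F) hE hk hv hM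
  simpa [hF] using this

/-- Convergence of the Turán densities, in Cauchy form. -/
theorem exists_turanNumber_div_choose_le_add {α : Type*} (k : ℕ) (F : Hypergraph α)
    [Fintype F.vertexSet] {ε : ℝ} (hε : 0 < ε) :
    ∃ M, k ≤ M ∧ Fintype.card F.vertexSet ≤ M ∧ ∀ n ≥ M,
      (turanNumber k M F : ℝ) / M.choose k ≤ turanNumber k n F / n.choose k + ε := by
  set m := max k (Fintype.card F.vertexSet) with hm
  let p : ℕ → ℝ := fun i => turanNumber k (m + i) F / (m + i).choose k
  have hk : ∀ i, k ≤ m + i := fun i => (le_max_left _ _).trans (Nat.le_add_right _ _)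
  have hv : ∀ i, Fintype.card F.vertexSet ≤ m + i :=
    fun i => (le_max_right _ _).trans (Nat.le_add_right _ _)
  have hp : Antitone p := fun i j hij =>
    turanNumber_div_choose_le (hk i) (hv i) (Nat.add_le_add_left hij m)
  have hb : BddBelow (Set.range p) := ⟨0, by rintro _ ⟨i, rfl⟩; positivity⟩
  obtain ⟨i, hi⟩ := exists_lt_of_ciInf_lt (lt_add_of_pos_right (iInf p) hε)
  refine ⟨m + i, hk i, hv i, fun n hn => ?_⟩
  obtain ⟨j, rfl⟩ := Nat.exists_eq_add_of_le ((Nat.le_add_right m i).trans hn)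
  have := ciInf_le hb j
  change p i ≤ p j + ε
  linarith

/-! ### From copies of F₀ to a copy of the blow-up -/

/-- A family without a blow-up `F` of `F₀` has few copies of `F₀`. -/
theorem exists_card_isCopy_le {α β : Type*} {k : ℕ} {F : Hypergraph α} {F₀ : Hypergraph β}
    [Fintype F.vertexSet] [Fintype F₀.vertexSet] (hF : F.IsUniform k) (hF₀ : F₀.IsUniform k)
    (hblow : F.IsBlowUp F₀) {δ : ℝ} (hδ : 0 < δ) :
    ∃ N : ℕ, ∀ n ≥ N, ∀ E : Finset (Finset (Fin n)), (∀ φ, ¬ F.IsCopy E φ) →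
      ∀ C : Finset (F₀.vertexSet → Fin n), (∀ φ ∈ C, F₀.IsCopy E φ) →
        (#C : ℝ) ≤ δ * (n : ℝ) ^ Fintype.card F₀.vertexSet := by
  classical
  obtain ⟨f, hf⟩ := hblow
  -- The extra 1 keeps the sets `A i` nonempty even if F has no vertices.
  obtain ⟨N, hN⟩ := exists_forall_piFinset_subset_of_fintype F₀.vertexSet
    (Fintype.card F.vertexSet + 1) hδ
  refine ⟨N, fun n hn E hE C hC => ?_⟩
  by_contra! hlt
  obtain ⟨A, hA, hAC⟩ := hN n hn C hlt.le
  have hne : ∀ i, (A i).Nonempty := fun i => card_pos.1 (by rw [hA]; lia)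
  choose b hb using hne
  -- A common point could represent both i and j in one transversal, which would then be a
  -- non-injective copy.
  have hdisj : ∀ i j, i ≠ j → ∀ x ∈ A i, x ∉ A j := by
    intro i j hij x hxi hxj
    have hmem : Function.update (Function.update b i x) j x ∈ C := by
      refine hAC _ fun l => ?_
      by_cases hlj : l = j
      · subst hlj; simpa using hxj
      · rw [Function.update_of_ne hlj]
        by_cases hli : l = i
        · subst hli; simpa using hxi
        · rw [Function.update_of_ne hli]; exact hb l
    refine hij ((hC _ hmem).1 ?_)
    rw [Function.update_of_ne hij]
    simp
  have hemb : ∀ i, Nonempty (F.vertexSet ↪ A i) := fun i => by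
    rw [Function.Embedding.nonempty_iff_card_le]
    simp [hA]
  let g : ∀ i, F.vertexSet ↪ A i := fun i => (hemb i).some
  let a : F.vertexSet → Fin n := fun x => g (f x) x
  have ha : ∀ x, a x ∈ A (f x) := fun x => (g (f x) x).2
  have hinj : Function.Injective a := by
    intro x y hxy
    have hfxy : f x = f y := by
      by_contra hne
      exact hdisj _ _ hne _ (ha x) (hxy ▸ ha y)
    have h1 : (g (f x) x : Fin n) = g (f x) y := by
      have : a x = a y := hxy
      simp only [a] at this
      rw [this, hfxy]
    exact (g (f x)).injective (Subtype.ext h1)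
  refine hE a ⟨hinj, fun e he => ?_⟩
  -- Uniformity enters here: e and its image under f both have k elements.
  have hinjOn : Set.InjOn f {x | (x : α) ∈ e} := by
    have h0 := hF₀ _ (hf e he)
    have hcard : {x : F.vertexSet | (x : α) ∈ e}.encard = k := by
      rw [← hF e he, ← Subtype.val_injective.encard_image]
      congr 1
      ext x
      constructor
      · rintro ⟨y, hy, rfl⟩; exact hy
      · intro hx
        exact ⟨⟨x, F.subset_vertexSet_of_mem_edgeSet he hx⟩, hx, rfl⟩
    have h1 := Set.Finite.injOn_of_encard_image_eq (s := {x : F.vertexSet | (x : α) ∈ e})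
      (f := fun x => (f x : β)) (Set.toFinite _) (by rw [h0, hcard])
    exact fun x hx y hy hxy => h1 hx hy (congrArg Subtype.val hxy)
  -- A transversal agreeing with `a` along e. Being a copy of F₀, it sends the edge f(e) to an edge,
  -- which is a(e).
  let φ : F₀.vertexSet → Fin n := fun i =>
    if h : ∃ x : F.vertexSet, (x : α) ∈ e ∧ f x = i then a h.choose else b i
  have hφA : ∀ i, φ i ∈ A i := by
    intro i
    simp only [φ]
    split_ifs with h
    · have := ha h.choose
      rwa [h.choose_spec.2] at this
    · exact hb i
  have hφ : ∀ x : F.vertexSet, (x : α) ∈ e → φ (f x) = a x := by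
    intro x hx
    have h : ∃ y : F.vertexSet, (y : α) ∈ e ∧ f y = f x := ⟨x, hx, rfl⟩
    simp only [φ, dif_pos h]
    exact congrArg a (hinjOn h.choose_spec.1 hx h.choose_spec.2)
  obtain ⟨e', he', h'⟩ := (hC φ (hAC φ hφA)).2 _ (hf e he)
  refine ⟨e', he', h'.trans ?_⟩
  ext y
  constructor
  · rintro ⟨i, ⟨x, hx, hxi⟩, rfl⟩
    obtain rfl : f x = i := Subtype.ext hxi
    exact ⟨x, hx, (hφ x hx).symm⟩
  · rintro ⟨x, hx, rfl⟩
    exact ⟨f x, ⟨x, hx, rfl⟩, hφ x hx⟩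

theorem pow_le_mul_choose {n v : ℕ} (h : 2 * v ≤ n) :
    (n : ℝ) ^ v ≤ 2 ^ v * v.factorial * n.choose v := by
  have h1 := Nat.pow_le_choose (α := ℝ) v n
  rw [div_le_iff₀ (by positivity)] at h1
  have h2 : (n : ℝ) / 2 ≤ ((n + 1 - v : ℕ) : ℝ) := by
    rw [div_le_iff₀ (by norm_num)]
    exact_mod_cast (by lia : n ≤ (n + 1 - v) * 2)
  calc (n : ℝ) ^ v = 2 ^ v * ((n : ℝ) / 2) ^ v := by rw [← mul_pow]; congr 1; ring
    _ ≤ 2 ^ v * ((n + 1 - v : ℕ) : ℝ) ^ v := by gcongr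
    _ ≤ 2 ^ v * (n.choose v * v.factorial) := by gcongr
    _ = _ := by ring

theorem eventually_turanNumber_le {α β : Type*} {k : ℕ} {F : Hypergraph α} {F₀ : Hypergraph β}
    [Fintype F.vertexSet] [Fintype F₀.vertexSet] (hF : F.IsUniform k) (hF₀ : F₀.IsUniform k)
    (hblow : F.IsBlowUp F₀) {ε : ℝ} (hε : 0 < ε) :
    ∀ᶠ n : ℕ in Filter.atTop,
      (turanNumber k n F : ℝ) ≤ turanNumber k n F₀ + ε * (n : ℝ) ^ k := by
  classical
  obtain ⟨M, hk, hv, hM⟩ := exists_turanNumber_div_choose_le_add k F₀ (half_pos hε)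
  set v := Fintype.card F₀.vertexSet with hv_def
  have hMv : (0 : ℝ) < M.choose v := by exact_mod_cast Nat.choose_pos hv
  -- Chosen so that copies of F₀ contribute at most ε/2, after n^v ≤ 2^v v! C(n, v); the choice of M
  -- costs the other ε/2.
  set δ : ℝ := ε / 2 / (2 ^ v * v.factorial * M.choose v) with hδ
  obtain ⟨N, hN⟩ := exists_card_isCopy_le hF hF₀ hblow (δ := δ) (by positivity)
  filter_upwards [Filter.eventually_ge_atTop (max N (max M (2 * v)))] with n hn
  simp only [max_le_iff] at hn
  obtain ⟨hnN, hnM, hnv⟩ := hn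
  have p1 : (0 : ℝ) < n.choose k := by exact_mod_cast Nat.choose_pos (hk.trans hnM)
  have p2 : (0 : ℝ) < n.choose v := by exact_mod_cast Nat.choose_pos (hv.trans hnM)
  refine (Nat.le_floor_iff (by positivity)).1 (turanNumber_le_iff.2 fun E hE hFE => ?_)
  rw [Nat.le_floor_iff (by positivity)]
  have h1 := card_div_choose_le (F := F₀) hE hk hv hnM
  have h2 := hN n hnN E hFE {φ | F₀.IsCopy E φ} (by simp)
  rw [← hv_def] at h1 h2
  have h3 : (#{φ | F₀.IsCopy E φ} : ℝ) / n.choose v * M.choose v ≤ ε / 2 := by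
    calc (#{φ | F₀.IsCopy E φ} : ℝ) / n.choose v * M.choose v
        ≤ δ * (2 ^ v * v.factorial * n.choose v) / n.choose v * M.choose v := by
          gcongr
          exact h2.trans (by gcongr; exact pow_le_mul_choose hnv)
      _ = ε / 2 := by rw [hδ]; field_simp
  have h4 : (#E : ℝ) / n.choose k ≤ turanNumber k n F₀ / n.choose k + ε := by
    linarith [hM n hnM]
  rw [div_le_iff₀ p1, add_mul, div_mul_cancel₀ _ p1.ne'] at h4
  have h5 : (n.choose k : ℝ) ≤ (n : ℝ) ^ k := by exact_mod_cast Nat.choose_le_pow n k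
  nlinarith

end Hypergraph

end

theorem mainTheorem7 {α : Type*} {β : Type*} (k : ℕ) (F : Hypergraph α) (F₀ : Hypergraph β)
    (hfin : F.vertexSet.Finite) (hfin₀ : F₀.vertexSet.Finite)
    (hF : F.IsUniform k) (hF₀ : F₀.IsUniform k) (hblow : F.IsBlowUp F₀) :
    ∃ g : ℕ → ℝ, g =o[Filter.atTop] (fun n : ℕ => (n : ℝ) ^ k) ∧
      ∀ n : ℕ, (Hypergraph.turanNumber k n F : ℝ) ≤ (Hypergraph.turanNumber k n F₀ : ℝ) + g n := by
  have := hfin.fintype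
  have := hfin₀.fintype
  -- The positive part of the difference suffices: only an upper bound on the difference is
  -- available.
  refine ⟨fun n => max 0 ((Hypergraph.turanNumber k n F : ℝ) - Hypergraph.turanNumber k n F₀),
    ?_, fun n => ?_⟩
  · rw [Asymptotics.isLittleO_iff]
    intro ε hε
    filter_upwards [Hypergraph.eventually_turanNumber_le hF hF₀ hblow hε] with n hn
    rw [Real.norm_of_nonneg (le_max_left _ _), Real.norm_of_nonneg (by positivity)]
    exact max_le (by positivity) (by linarith)
  · linarith [le_max_right 0
      ((Hypergraph.turanNumber k n F : ℝ) - Hypergraph.turanNumber k n F₀)]
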